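/- Let $\mathbf{No}$ be the ordered field of surreal numbers, let $x\mapsto\omega^x$ be Conway's omega map, so that $\omega^x=\{0,\,n\,\omega^{x^L}\mid 2^{-n}\omega^{x^R}\}$ ($n\in\mathbb N$), and let $v$ be the natural valuation of $\mathbf{No}$ with value group $(\mathbf{No},+,<)$: $v(0)=\infty$, and for $a\neq 0$, $v(a)=-y$ where $\omega^{y}$ is the unique power of $\omega$ in the archimedean class of $a$ (equivalently, $y$ is the largest exponent in the Conway normal form of $a$). Thus $\mathbf{No}$ is the Hahn field $\mathbb{R}(\!(\mathbf{No})\!)$ with $t^{g}=\omega^{-g}$ and $v$ is its $t$-adic valuation; write $[a]_g$ for the coefficient of $t^g$ in $a$. Let $\mathrm{Aut}(\mathbf{No},+,\cdot,\omega^x)$ be the group of all field automorphisms $\sigma$ of $\mathbf{No}$ with $\sigma(\omega^x)=\omega^{\sigma(x)}$ for all $x\in\mathbf{No}$. Proposition. If $\sigma\in\mathrm{Aut}(\mathbf{No},+,\cdot,\omega^x)$ satisfies $v(\sigma(a))=v(a)$ for all $a\in\mathbf{No}$, then $\sigma$ is the identity. In particular, the group $1\text{-}\mathrm{Aut}(\mathbf{No},+,\cdot,\omega^x)$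 is trivial. Here $1\text{-}\mathrm{Aut}(\mathbf{No},+,\cdot,\omega^x)$ consists of all $\sigma\in\mathrm{Aut}(\mathbf{No},+,\cdot,\omega^x)$ such that - $v(a)<v(b)\Leftrightarrow v(\sigma(a))<v(\sigma(b))$ for all $a,b\in\mathbf{No}$; - $v(\sigma(t^g))=g$ for all $g\in\mathbf{No}$, and $[\sigma(r)]_0=r$ for all $r\in\mathbb{R}$; - $[\sigma(a)]_{v(a)}=[a]_{v(a)}$ for all nonzero $a\in\mathbf{No}$. -/

import Mathlib

universe u

/-- A surreal number, as a sign sequence of ordinal length: a map from the ordinals to the signs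
`{-1, 0, 1}` which is nonzero exactly below the ordinal `length`
(the value `0` means that the sequence has already stopped). -/
structure Surreal : Type (u + 1) where
  sign : Ordinal.{u} → SignType
  length : Ordinal.{u}
  sign_ne_zero_iff : ∀ β, sign β ≠ 0 ↔ β < length

namespace Surreal

/-- The lexicographic order on sign sequences, with `- < (stopped) < +`. -/
instance : LT Surreal.{u} where
  lt x y := ∃ β, (∀ γ < β, x.sign γ = y.sign γ) ∧ x.sign β < y.sign β

/-- The empty sign sequence. -/
instance : Zero Surreal.{u} where
  zero := ⟨fun _ => 0, 0, fun β => by simp⟩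

/-- The sign sequence `(+)` of length one. -/
noncomputable instance : One Surreal.{u} where
  one := ⟨fun β => if β = 0 then 1 else 0, 1, fun β => by simp⟩

/-- Negation reverses all signs. -/
instance : Neg Surreal.{u} where
  neg x := ⟨fun β => - x.sign β, x.length, fun β => by
    rw [← x.sign_ne_zero_iff β]
    cases x.sign β <;> decide⟩

/-- The simplicity order: `x` is a proper initial segment of `y`. -/
def Simpler (x y : Surreal.{u}) : Prop :=
  x.length < y.length ∧ ∀ β < x.length, x.sign β = y.sign β

/-- The canonical left options `xᴸ` of `x`. -/
def leftOptions (x : Surreal.{u}) : Set Surreal.{u} := {l | l.Simpler x ∧ l < x}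

/-- The canonical right options `xᴿ` of `x`. -/
def rightOptions (x : Surreal.{u}) : Set Surreal.{u} := {r | r.Simpler x ∧ x < r}

theorem length_lt_of_left {x l : Surreal.{u}} (h : l ∈ leftOptions x) : l.length < x.length :=
  h.1.1

theorem length_lt_of_right {x r : Surreal.{u}} (h : r ∈ rightOptions x) : r.length < x.length :=
  h.1.1

open Classical in
/-- The simplest element of a nonempty convex class `P`, i.e. its unique element of least length
(and `0` if `P` is empty). -/
noncomputable def simplest (P : Set Surreal.{u}) : Surreal.{u} :=
  if h : P.Nonempty then Function.argminOn Surreal.length P h else 0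

/-- `{L | R}`: the simplest surreal number above all of `L` and below all of `R`. -/
noncomputable def cut (L R : Set Surreal.{u}) : Surreal.{u} :=
  simplest {z | (∀ l ∈ L, l < z) ∧ (∀ r ∈ R, z < r)}

/-- Conway's sum: `x + y = {xᴸ + y, x + yᴸ | xᴿ + y, x + yᴿ}`. -/
noncomputable def add (x y : Surreal.{u}) : Surreal.{u} :=
  cut ({z | ∃ (l : Surreal.{u}) (_ : l ∈ leftOptions x), z = add l y} ∪
        {z | ∃ (l : Surreal.{u}) (_ : l ∈ leftOptions y), z = add x l})
      ({z | ∃ (r : Surreal.{u}) (_ : r ∈ rightOptions x), z = add r y} ∪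
        {z | ∃ (r : Surreal.{u}) (_ : r ∈ rightOptions y), z = add x r})
termination_by (x.length, y.length)
decreasing_by
  · exact Prod.Lex.left _ _ (length_lt_of_left ‹_›)
  · exact Prod.Lex.right _ (length_lt_of_left ‹_›)
  · exact Prod.Lex.left _ _ (length_lt_of_right ‹_›)
  · exact Prod.Lex.right _ (length_lt_of_right ‹_›)

noncomputable instance : Add Surreal.{u} := ⟨add⟩

noncomputable instance : Sub Surreal.{u} := ⟨fun x y => x + -y⟩

/-- Conway's product: `x y` is the cut with left elements `x' y + x y' - x' y'` for
`(x', y') = (xᴸ, yᴸ), (xᴿ, yᴿ)`, and right elements given by the same expression for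
`(x', y') = (xᴸ, yᴿ), (xᴿ, yᴸ)`. -/
noncomputable def mul (x y : Surreal.{u}) : Surreal.{u} :=
  cut ({z | ∃ (a : Surreal.{u}) (_ : a ∈ leftOptions x) (b : Surreal.{u})
            (_ : b ∈ leftOptions y), z = mul a y + mul x b - mul a b} ∪
        {z | ∃ (a : Surreal.{u}) (_ : a ∈ rightOptions x) (b : Surreal.{u})
            (_ : b ∈ rightOptions y), z = mul a y + mul x b - mul a b})
      ({z | ∃ (a : Surreal.{u}) (_ : a ∈ leftOptions x) (b : Surreal.{u})
            (_ : b ∈ rightOptions y), z = mul a y + mul x b - mul a b} ∪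
        {z | ∃ (a : Surreal.{u}) (_ : a ∈ rightOptions x) (b : Surreal.{u})
            (_ : b ∈ leftOptions y), z = mul a y + mul x b - mul a b})
termination_by (x.length, y.length)
decreasing_by
  all_goals
    first
      | exact Prod.Lex.left _ _ (length_lt_of_left ‹_›)
      | exact Prod.Lex.left _ _ (length_lt_of_right ‹_›)
      | exact Prod.Lex.right _ (length_lt_of_left ‹_›)
      | exact Prod.Lex.right _ (length_lt_of_right ‹_›)

noncomputable instance : Mul Surreal.{u} := ⟨mul⟩

open Classical in
/-- The absolute value. -/
noncomputable def abs (x : Surreal.{u}) : Surreal.{u} := if x < 0 then -x else x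

/-- The omega map: `ω^x` is the simplest positive surreal number which is larger than all
finite multiples of the `ω^(xᴸ)` and all of whose finite multiples are smaller than the
`ω^(xᴿ)`; that is, `ω^x = {0, n ω^(xᴸ) | 2⁻ⁿ ω^(xᴿ)}`.
Here `nsmulRec n z` is the `n`-fold sum of `z`. -/
noncomputable def omega (x : Surreal.{u}) : Surreal.{u} :=
  simplest {z | 0 < z ∧
    (∀ (l : Surreal.{u}) (_ : l ∈ leftOptions x) (n : ℕ), nsmulRec n (omega l) < z) ∧
    (∀ (r : Surreal.{u}) (_ : r ∈ rightOptions x) (n : ℕ), nsmulRec n z < omega r)}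
termination_by x.length
decreasing_by
  all_goals
    first
      | exact length_lt_of_left ‹_›
      | exact length_lt_of_right ‹_›

/-- The embedding of the real numbers: `r` is sent to the simplest surreal number filling the
cut which `r` determines in the rational numbers `m / n`. -/
noncomputable def ofReal (r : ℝ) : Surreal.{u} :=
  simplest {z | ∀ (m : ℤ) (n : ℕ), 0 < n →
    ((m : ℝ) / n < r → zsmulRec nsmulRec m (1 : Surreal.{u}) < nsmulRec n z) ∧
    (r < (m : ℝ) / n → nsmulRec n z < zsmulRec nsmulRec m (1 : Surreal.{u}))}

/-- Archimedean equivalence of nonzero surreal numbers. -/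
def ArchEquiv (a b : Surreal.{u}) : Prop :=
  ∃ n : ℕ, abs a < nsmulRec n (abs b) ∧ abs b < nsmulRec n (abs a)

open Classical in
/-- The valuation of `No = ℝ((No))`, with `ω^x` identified with `t^(-x)`: `v 0 = ∞`, and for
`a ≠ 0`, `v a = -y` where `ω^y` is the unique power of `ω` in the archimedean class of `a`,
i.e. `y` is the largest exponent in the Conway normal form of `a`. -/
noncomputable def v (a : Surreal.{u}) : WithTop Surreal.{u} :=
  if a = 0 then ⊤
  else ((-(Classical.epsilon fun y : Surreal.{u} => ArchEquiv a (omega y)) : Surreal.{u}) :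
    WithTop Surreal.{u})

/-- The formal monomial `t^g = ω^(-g)`. -/
noncomputable def monomial (g : Surreal.{u}) : Surreal.{u} := omega (-g)

/-- `s = r t^g + (terms of valuation > g)`: the series `s` has no term of valuation `< g`,
and its coefficient `[s]_g` is `r`. (For `g ≤ v s` this says just that `[s]_g = r`.) -/
def HasCoeff (s g : Surreal.{u}) (r : ℝ) : Prop :=
  (g : WithTop Surreal.{u}) < v (s - ofReal r * monomial g)

/-- `Aut(No, +, ·, ω^x)`: the field automorphisms which commute with the omega map. -/
def omegaAut : Set (Surreal.{u} ≃+* Surreal.{u}) :=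
  {σ | ∀ x, σ (omega x) = omega (σ x)}

/-- `v-Aut(No, +, ·)`: the valuation preserving field automorphisms. -/
def valAut : Set (Surreal.{u} ≃+* Surreal.{u}) :=
  {σ | ∀ a b, v a < v b ↔ v (σ a) < v (σ b)}

/-- `Int(No, +, ·)`: the valuation preserving automorphisms which induce the identity on the
value group, `v (σ (t^g)) = g`, and on the residue field, `[σ r]_0 = r`. -/
def intAut : Set (Surreal.{u} ≃+* Surreal.{u}) :=
  {σ | σ ∈ valAut ∧ (∀ g : Surreal.{u}, v (σ (monomial g)) = g) ∧
    ∀ r : ℝ, HasCoeff (σ (ofReal r)) 0 r}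

/-- `1-Aut(No, +, ·)`: the internal automorphisms with `[σ a]_{v a} = [a]_{v a}`
for all `a ≠ 0`. -/
def oneAut : Set (Surreal.{u} ≃+* Surreal.{u}) :=
  {σ | σ ∈ intAut ∧ ∀ (a g : Surreal.{u}) (r : ℝ), v a = g →
    (HasCoeff (σ a) g r ↔ HasCoeff a g r)}

end Surreal

/-!
The point is that the valuation recovers the argument of the omega map: `v (ω^x) = -x` (`v_omega`).
If `σ` commutes with the omega map and preserves the valuation of the powers of `ω`, then
`-σ x = v (ω^(σ x)) = v (σ (ω^x)) = v (ω^x) = -x`, so `σ x = x` (`eq_refl_of_v_omega`). An element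
of `1-Aut` preserves the valuation of the monomials `t^g = ω^(-g)` by definition, so both parts of
the theorem follow; no more about the Hahn field structure of the surreal numbers is used.

The formula for `v (ω^x)` amounts to the fact that distinct powers of `ω` are not archimedean
equivalent: `n ω^x < ω^y` for `x < y` and all `n` (`nsmul_omega_lt_omega`). For numbers of which
one is simpler than the other this is built into the recursive definition of `ω^y`; in general one
passes through the longest common initial segment of `x` and `y` (`rel_of_lt`). What has to be
proved is that the recursion is legitimate, i.e. that the class whose simplest element is taken is
nonempty (`omega_mem_omegaClass`). This rests on two facts: every small cut in the surreal numbers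
is filled (`between_nonempty`), and the surreal numbers are an ordered abelian group, in which one
can halve a bound of a class closed under addition without leaving the upper bounds of that class
(`exists_add_self_le`).

Conversely, that the identity lies in `1-Aut` needs `[r]_0 = r` for real `r`, which comes down to
`ω^0 = 1` and `x * 1 = x`.
-/

namespace Surreal

/-! ### The order on sign sequences -/

theorem sign_injective : Function.Injective (sign : Surreal.{u} → Ordinal.{u} → SignType) := by
  intro x y h
  have hl : x.length = y.length := eq_of_forall_lt_iff fun β => by
    rw [← x.sign_ne_zero_iff, ← y.sign_ne_zero_iff, h]
  cases x
  cases y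
  cases h
  cases hl
  rfl

theorem sign_eq_zero_iff (x : Surreal.{u}) (β : Ordinal.{u}) : x.sign β = 0 ↔ x.length ≤ β := by
  rw [← not_lt, ← x.sign_ne_zero_iff, not_not]

/-- The order is the one induced by the lexicographic order on sign functions. -/
noncomputable instance : LinearOrder Surreal.{u} where
  le x y := toLex x.sign ≤ toLex y.sign
  lt := (· < ·)
  le_refl _ := le_refl (α := Lex (Ordinal.{u} → SignType)) _
  le_trans _ _ _ := le_trans (α := Lex (Ordinal.{u} → SignType))
  lt_iff_le_not_ge x y :=
    lt_iff_le_not_ge (α := Lex (Ordinal.{u} → SignType)) (a := toLex x.sign) (b := toLex y.sign)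
  le_antisymm _ _ h h' :=
    sign_injective (toLex.injective (le_antisymm (α := Lex (Ordinal.{u} → SignType)) h h'))
  le_total _ _ := le_total (α := Lex (Ordinal.{u} → SignType)) _ _
  toDecidableLE := Classical.decRel _

/-- The initial segment of `x` of length `min β x.length`. -/
noncomputable def truncate (x : Surreal.{u}) (β : Ordinal.{u}) : Surreal.{u} where
  sign γ := if γ < β then x.sign γ else 0
  length := min β x.length
  sign_ne_zero_iff γ := by
    split_ifs with h <;> simp [h, x.sign_ne_zero_iff]

theorem truncate_eq_self {x : Surreal.{u}} {β : Ordinal.{u}} (h : x.sign β = 0) :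
    x.truncate β = x := by
  apply sign_injective
  funext γ
  rw [sign_eq_zero_iff] at h
  by_cases hγ : γ < β
  · simp [truncate, hγ]
  · simp [truncate, hγ, ((x.sign_eq_zero_iff γ).2 (h.trans (not_lt.1 hγ)))]

theorem truncate_simpler {x : Surreal.{u}} {β : Ordinal.{u}} (h : x.sign β ≠ 0) :
    (x.truncate β).Simpler x := by
  have h' := (x.sign_ne_zero_iff β).1 h
  refine ⟨by simpa [truncate] using h', fun γ hγ => ?_⟩
  have : γ < β := lt_of_lt_of_le hγ (min_le_left _ _)
  simp [truncate, this]

theorem truncate_congr {x y : Surreal.{u}} {β : Ordinal.{u}}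
    (h : ∀ γ < β, x.sign γ = y.sign γ) : x.truncate β = y.truncate β := by
  apply sign_injective
  funext γ
  by_cases hγ : γ < β <;> simp [truncate, hγ, h]

/-- Between two surreal numbers lies their longest common initial segment. -/
theorem exists_common_segment {x y : Surreal.{u}} (h : x < y) :
    ∃ c, x ≤ c ∧ c ≤ y ∧ (c = x ∨ c.Simpler x) ∧ (c = y ∨ c.Simpler y) := by
  obtain ⟨β, hβ, hlt⟩ := h
  have hc := truncate_congr hβ
  refine ⟨x.truncate β, ?_, ?_, ?_, ?_⟩
  · by_cases h0 : x.sign β = 0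
    · rw [truncate_eq_self h0]
    · refine le_of_lt ⟨β, fun γ hγ => by simp [truncate, hγ], ?_⟩
      simp only [truncate, lt_irrefl, if_false]
      revert h0 hlt
      cases x.sign β <;> cases y.sign β <;> decide
  · rw [hc]
    by_cases h0 : y.sign β = 0
    · rw [truncate_eq_self h0]
    · refine le_of_lt ⟨β, fun γ hγ => by simp [truncate, hγ], ?_⟩
      simp only [truncate, lt_irrefl, if_false]
      revert h0 hlt
      cases x.sign β <;> cases y.sign β <;> decide
  · exact (em (x.sign β = 0)).imp truncate_eq_self truncate_simpler
  · rw [hc]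
    exact (em (y.sign β = 0)).imp truncate_eq_self truncate_simpler

/-- A transitive relation which holds between every number of length `< o` and its options
holds along the order. -/
theorem rel_of_lt {r : Surreal.{u} → Surreal.{u} → Prop}
    (htrans : ∀ a b c, r a b → r b c → r a c) {o : Ordinal.{u}}
    (hl : ∀ x, x.length < o → ∀ l ∈ leftOptions x, r l x)
    (hr : ∀ x, x.length < o → ∀ s ∈ rightOptions x, r x s) {x y : Surreal.{u}}
    (hx : x.length < o) (hy : y.length < o) (h : x < y) : r x y := by
  obtain ⟨c, hxc, hcy, h1, h2⟩ := exists_common_segment h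
  rcases hxc.eq_or_lt with rfl | hxc
  · exact hl y hy _ ⟨h2.resolve_left h.ne, h⟩
  have hcx := hr x hx c ⟨h1.resolve_left hxc.ne', hxc⟩
  rcases hcy.eq_or_lt with rfl | hcy
  · exact hcx
  · exact htrans _ _ _ hcx (hl y hy c ⟨h2.resolve_left hcy.ne, hcy⟩)

theorem small_length_lt (o : Ordinal.{u}) : Small.{u} {x : Surreal.{u} | x.length < o} := by
  refine small_of_injective (β := Set.Iio o → SignType) (f := fun x β => x.1.sign β.1) ?_
  rintro ⟨x, hx⟩ ⟨y, hy⟩ h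
  refine Subtype.ext (sign_injective (funext fun β => ?_))
  by_cases hβ : β < o
  · exact congrFun h ⟨β, hβ⟩
  · have hβ := not_lt.1 hβ
    rw [(x.sign_eq_zero_iff β).2 (le_trans (le_of_lt hx) hβ),
      (y.sign_eq_zero_iff β).2 (le_trans (le_of_lt hy) hβ)]

instance (x : Surreal.{u}) : Small.{u} (leftOptions x) :=
  have := small_length_lt.{u} x.length
  small_subset (s := {y : Surreal.{u} | y.length < x.length}) (t := leftOptions x)
    fun _ h => length_lt_of_left h

instance (x : Surreal.{u}) : Small.{u} (rightOptions x) :=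
  have := small_length_lt.{u} x.length
  small_subset (s := {y : Surreal.{u} | y.length < x.length}) (t := rightOptions x)
    fun _ h => length_lt_of_right h

/-! ### Cuts -/

/-- The class of all numbers above `L` and below `R`. -/
def between (L R : Set Surreal.{u}) : Set Surreal.{u} :=
  {z | (∀ l ∈ L, l < z) ∧ (∀ r ∈ R, z < r)}

open Classical in
/-- The signs of a number between `L` and `R`, produced greedily: at place `β`, the sequence goes
up if its initial segment below `β` is not above all of `L`, goes down if that segment is not
below all of `R`, and stops otherwise. -/
noncomputable def fillSign (L R : Set Surreal.{u}) (β : Ordinal.{u}) : SignType :=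
  if ∃ (γ : Ordinal.{u}) (_ : γ < β), fillSign L R γ = 0 then 0
  else if ∃ l ∈ L, ¬ toLex l.sign < toLex (fun γ => if _ : γ < β then fillSign L R γ else 0) then 1
  else if ∃ r ∈ R, ¬ toLex (fun γ => if _ : γ < β then fillSign L R γ else 0) < toLex r.sign then -1
  else 0
termination_by β
decreasing_by all_goals assumption

/-- A small cut is filled. -/
theorem between_nonempty {L R : Set Surreal.{u}} [Small.{u} L] [Small.{u} R]
    (h : ∀ l ∈ L, ∀ r ∈ R, l < r) : (between L R).Nonempty := by
  set f := fillSign L R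
  let p : Ordinal.{u} → Lex (Ordinal.{u} → SignType) := fun β =>
    toLex fun γ => if _ : γ < β then f γ else 0
  have hp : ∀ β γ, p β γ = if γ < β then f γ else 0 := fun _ _ => rfl
  have hfβ : ∀ β, (∀ γ < β, f γ ≠ 0) →
      (f β = 1 ∧ ∃ l ∈ L, ¬ toLex l.sign < p β) ∨
      (f β = -1 ∧ ∃ r ∈ R, ¬ p β < toLex r.sign) ∨
      (f β = 0 ∧ (∀ l ∈ L, toLex l.sign < p β) ∧ ∀ r ∈ R, p β < toLex r.sign) := by
    intro β hβ
    have h0 : ¬ ∃ (γ : Ordinal.{u}) (_ : γ < β), fillSign L R γ = 0 := by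
      rintro ⟨γ, hγ, h⟩
      exact hβ γ hγ h
    have hfβ : f β = _ := fillSign.eq_1 L R β
    rw [if_neg h0] at hfβ
    by_cases h1 : ∃ l ∈ L, ¬ toLex l.sign < p β
    · exact Or.inl ⟨hfβ.trans (if_pos h1), h1⟩
    · have hfβ := hfβ.trans (if_neg h1)
      by_cases h2 : ∃ r ∈ R, ¬ p β < toLex r.sign
      · exact Or.inr (Or.inl ⟨hfβ.trans (if_pos h2), h2⟩)
      · push Not at h1 h2
        exact Or.inr (Or.inr ⟨hfβ.trans (if_neg (by push Not; exact h2)), h1, h2⟩)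
  -- As long as the sequence runs, no element of `L` has passed above it, nor one of `R` below it.
  have invL : ∀ β, (∀ γ < β, f γ ≠ 0) → ∀ l ∈ L, (∀ γ < β, l.sign γ = f γ) → ¬ f β < l.sign β := by
    intro β hβ l hl hagree hlt
    have hlow : p β ≤ toLex l.sign := by
      rcases lt_trichotomy (l.sign β) 0 with hneg | h0 | hpos
      · exfalso
        revert hlt hneg
        cases l.sign β <;> cases f β <;> decide
      · refine le_of_eq (funext fun γ => ?_)
        rw [hp]
        split_ifs with hγ
        · exact (hagree γ hγ).symm
        · exact ((l.sign_eq_zero_iff γ).2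
            (((l.sign_eq_zero_iff β).1 h0).trans (not_lt.1 hγ))).symm
      · refine le_of_lt ⟨β, fun γ hγ => ?_, ?_⟩
        · rw [hp, if_pos hγ]; exact (hagree γ hγ).symm
        · rw [hp, if_neg (lt_irrefl _)]; exact hpos
    rcases hfβ β hβ with ⟨h1, -⟩ | ⟨-, r, hr, hpr⟩ | ⟨-, hL, -⟩
    · rw [h1] at hlt
      revert hlt
      cases l.sign β <;> decide
    · exact hpr (lt_of_le_of_lt hlow (h l hl r hr))
    · exact (hL l hl).not_ge hlow
  have invR : ∀ β, (∀ γ < β, f γ ≠ 0) → ∀ r ∈ R, (∀ γ < β, r.sign γ = f γ) → ¬ r.sign β < f β := by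
    intro β hβ r hr hagree hlt
    have hlow : toLex r.sign ≤ p β := by
      rcases lt_trichotomy (r.sign β) 0 with hneg | h0 | hpos
      · refine le_of_lt ⟨β, fun γ hγ => ?_, ?_⟩
        · rw [hp, if_pos hγ]; exact hagree γ hγ
        · rw [hp, if_neg (lt_irrefl _)]; exact hneg
      · refine le_of_eq (funext fun γ => ?_)
        rw [hp]
        split_ifs with hγ
        · exact hagree γ hγ
        · exact (r.sign_eq_zero_iff γ).2
            (((r.sign_eq_zero_iff β).1 h0).trans (not_lt.1 hγ))
      · exfalso
        revert hlt hpos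
        cases r.sign β <;> cases f β <;> decide
    rcases hfβ β hβ with ⟨-, l, hl, hpl⟩ | ⟨h1, -⟩ | ⟨-, -, hR⟩
    · exact hpl (lt_of_lt_of_le (h l hl r hr) hlow)
    · rw [h1] at hlt
      revert hlt
      cases r.sign β <;> decide
    · exact (hR r hr).not_ge hlow
  obtain ⟨o, ho⟩ : ∃ o : Ordinal.{u}, ∀ z ∈ L ∪ R, z.length ≤ o := by
    obtain ⟨o, ho⟩ := Ordinal.bddAbove_of_small (s := length '' (L ∪ R))
    exact ⟨o, fun z hz => ho ⟨z, hz, rfl⟩⟩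
  -- The sequence stops, as it cannot be followed beyond the lengths of all bounds.
  have hzero : ∃ β, f β = 0 := by
    by_contra! hne
    have hcmp : ∀ z ∈ L ∪ R, ∃ β < Order.succ o, (∀ γ < β, z.sign γ = f γ) ∧ z.sign β ≠ f β := by
      intro z hz
      have hex : ∃ β, z.sign β ≠ f β :=
        ⟨o, by rw [(z.sign_eq_zero_iff o).2 (ho z hz)]; exact (hne o).symm⟩
      obtain ⟨β, hβ, hmin⟩ := WellFounded.has_min (wellFounded_lt (α := Ordinal.{u}))
        {β | z.sign β ≠ f β} hex
      have hlt : β < Order.succ o := by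
        by_contra hge
        refine hmin o ?_ (Order.succ_le_iff.1 (not_lt.1 hge))
        change z.sign o ≠ f o
        rw [(z.sign_eq_zero_iff o).2 (ho z hz)]
        exact (hne o).symm
      exact ⟨β, hlt, fun γ hγ => not_not.1 fun hh => hmin γ hh hγ, hβ⟩
    rcases hfβ (Order.succ o) fun γ _ => hne γ with ⟨-, l, hl, hpl⟩ | ⟨-, r, hr, hpr⟩ | ⟨h0, -⟩
    · obtain ⟨β, hβo, hβ, hβne⟩ := hcmp l (Or.inl hl)
      refine hpl ⟨β, fun γ hγ => ?_, ?_⟩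
      · rw [hp, if_pos (hγ.trans hβo)]; exact hβ γ hγ
      · rw [hp, if_pos hβo]
        exact lt_of_le_of_ne (not_lt.1 (invL β (fun γ _ => hne γ) l hl hβ)) hβne
    · obtain ⟨β, hβo, hβ, hβne⟩ := hcmp r (Or.inr hr)
      refine hpr ⟨β, fun γ hγ => ?_, ?_⟩
      · rw [hp, if_pos (hγ.trans hβo)]; exact (hβ γ hγ).symm
      · rw [hp, if_pos hβo]
        exact lt_of_le_of_ne (not_lt.1 (invR β (fun γ _ => hne γ) r hr hβ)) hβne.symm
    · exact hne _ h0
  obtain ⟨β, hβ, hmin⟩ := WellFounded.has_min (wellFounded_lt (α := Ordinal.{u}))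
    {β | f β = 0} hzero
  have hrun : ∀ γ < β, f γ ≠ 0 := fun γ hγ h0 => hmin γ h0 hγ
  rcases hfβ β hrun with ⟨h1, -⟩ | ⟨h1, -⟩ | ⟨-, hL, hR⟩
  · rw [show f β = 0 from hβ] at h1; exact absurd h1 (by decide)
  · rw [show f β = 0 from hβ] at h1; exact absurd h1 (by decide)
  · refine ⟨⟨p β, β, fun γ => ?_⟩, hL, hR⟩
    rw [hp]
    split_ifs with hγ <;> simp [hγ, hrun]

theorem simplest_mem {P : Set Surreal.{u}} (h : P.Nonempty) : simplest P ∈ P := by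
  rw [simplest, dif_pos h]
  exact Function.argminOn_mem _ _ _

theorem length_simplest_le {P : Set Surreal.{u}} {z : Surreal.{u}} (h : z ∈ P) :
    (simplest P).length ≤ z.length := by
  rw [simplest, dif_pos ⟨z, h⟩]
  exact Function.argminOn_le _ _ h

/-- Every number which fills the canonical cut of `x` extends the sign sequence of `x`. -/
theorem eq_or_simpler_of_mem_between_options {x z : Surreal.{u}}
    (h : z ∈ between (leftOptions x) (rightOptions x)) : z = x ∨ x.Simpler z := by
  rcases lt_trichotomy z x with hzx | rfl | hxz
  · obtain ⟨c, hzc, hcx, h1, h2⟩ := exists_common_segment hzx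
    rcases hcx.eq_or_lt with rfl | hcx
    · exact Or.inr (h1.resolve_left hzx.ne')
    · exact absurd (h.1 c ⟨h2.resolve_left hcx.ne, hcx⟩) hzc.not_gt
  · exact Or.inl rfl
  · obtain ⟨c, hxc, hcz, h1, h2⟩ := exists_common_segment hxz
    rcases hxc.eq_or_lt with rfl | hxc
    · exact Or.inr (h2.resolve_left hxz.ne)
    · exact absurd (h.2 c ⟨h1.resolve_left hxc.ne', hxc⟩) hcz.not_gt

theorem cut_options (x : Surreal.{u}) : cut (leftOptions x) (rightOptions x) = x := by
  have hx : x ∈ between (leftOptions x) (rightOptions x) := ⟨fun l h => h.2, fun r h => h.2⟩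
  exact (eq_or_simpler_of_mem_between_options (simplest_mem ⟨x, hx⟩)).resolve_right
    fun h => (length_simplest_le hx).not_gt h.1

/-- Conway's comparison of two cuts. -/
theorem le_of_options {L R L' R' : Set Surreal.{u}} {x y : Surreal.{u}}
    (hx : x = cut L R) (hxm : x ∈ between L R) (hy : y = cut L' R') (hym : y ∈ between L' R')
    (hL : ∀ l ∈ L, l < y) (hR : ∀ r ∈ R', x < r) : x ≤ y := by
  by_contra! hyx
  have hyL : y ∈ between L R := ⟨hL, fun r hr => hyx.trans (hxm.2 r hr)⟩
  have hxR : x ∈ between L' R' := ⟨fun l hl => (hym.1 l hl).trans hyx, hR⟩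
  have h1 : x.length ≤ y.length := hx ▸ length_simplest_le hyL
  have h2 : y.length ≤ x.length := hy ▸ length_simplest_le hxR
  obtain ⟨c, hyc, hcx, hcy, hcx'⟩ := exists_common_segment hyx
  have hc : c ∈ between L R :=
    ⟨fun l hl => (hL l hl).trans_le hyc, fun r hr => hcx.trans_lt (hxm.2 r hr)⟩
  have h3 : x.length ≤ c.length := hx ▸ length_simplest_le hc
  rcases hcx' with rfl | hcx'
  · rcases hcy with rfl | hcy
    · exact hyx.false
    · exact h2.not_gt hcy.1
  · exact h3.not_gt hcx'.1

/-! ### Addition -/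

/-- The left elements of the cut which defines `x + y`. -/
def addLeft (x y : Surreal.{u}) : Set Surreal.{u} :=
  (· + y) '' leftOptions x ∪ (x + ·) '' leftOptions y

/-- The right elements of the cut which defines `x + y`. -/
def addRight (x y : Surreal.{u}) : Set Surreal.{u} :=
  (· + y) '' rightOptions x ∪ (x + ·) '' rightOptions y

theorem add_eq_cut (x y : Surreal.{u}) : x + y = cut (addLeft x y) (addRight x y) := by
  change add x y = _
  rw [add]
  simp only [addLeft, addRight, Set.image, exists_prop, eq_comm]
  rfl

instance (x y : Surreal.{u}) : Small.{u} (addLeft x y) := by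
  unfold addLeft; infer_instance

instance (x y : Surreal.{u}) : Small.{u} (addRight x y) := by
  unfold addRight; infer_instance

/-- The cut defining `x + y` is a genuine one. Monotonicity in each argument, needed to see this, is
part of the statement for the simpler pairs. -/
theorem add_mem_between (x y : Surreal.{u}) : x + y ∈ between (addLeft x y) (addRight x y) := by
  suffices H : ∀ a : Ordinal.{u} × Ordinal.{u}, ∀ x y : Surreal.{u}, (x.length, y.length) = a →
      x + y ∈ between (addLeft x y) (addRight x y) from H _ x y rfl
  intro a
  induction a using WellFounded.induction
    (r := Prod.Lex (α := Ordinal.{u}) (β := Ordinal.{u}) (· < ·) (· < ·))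
    (hwf := WellFounded.prod_lex wellFounded_lt wellFounded_lt) with
  | _ a ih
  rintro x y rfl
  have ih1 : ∀ x' y' : Surreal.{u}, x'.length < x.length →
      x' + y' ∈ between (addLeft x' y') (addRight x' y') :=
    fun x' y' h => ih _ (Prod.Lex.left _ _ h) x' y' rfl
  have ih2 : ∀ y' : Surreal.{u}, y'.length < y.length →
      x + y' ∈ between (addLeft x y') (addRight x y') :=
    fun y' h => ih _ (Prod.Lex.right _ h) x y' rfl
  rw [add_eq_cut x y]
  refine simplest_mem (between_nonempty ?_)
  rintro _ (⟨l, hl, rfl⟩ | ⟨l, hl, rfl⟩) _ (⟨r, hr, rfl⟩ | ⟨r, hr, rfl⟩)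
  · exact rel_of_lt (r := fun a b => a + y < b + y) (fun _ _ _ => lt_trans)
      (fun z hz l' hl' => (ih1 z y hz).1 _ (Or.inl ⟨l', hl', rfl⟩))
      (fun z hz s hs => (ih1 z y hz).2 _ (Or.inl ⟨s, hs, rfl⟩))
      (length_lt_of_left hl) (length_lt_of_right hr) (hl.2.trans hr.2)
  · exact ((ih1 l y (length_lt_of_left hl)).2 _ (Or.inr ⟨r, hr, rfl⟩)).trans
      ((ih2 r (length_lt_of_right hr)).1 _ (Or.inl ⟨l, hl, rfl⟩))
  · exact ((ih2 l (length_lt_of_left hl)).2 _ (Or.inl ⟨r, hr, rfl⟩)).trans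
      ((ih1 r y (length_lt_of_right hr)).1 _ (Or.inr ⟨l, hl, rfl⟩))
  · exact rel_of_lt (r := fun a b => x + a < x + b) (fun _ _ _ => lt_trans)
      (fun z hz l' hl' => (ih2 z hz).1 _ (Or.inr ⟨l', hl', rfl⟩))
      (fun z hz s hs => (ih2 z hz).2 _ (Or.inr ⟨s, hs, rfl⟩))
      (length_lt_of_left hl) (length_lt_of_right hr) (hl.2.trans hr.2)

theorem strictMono_add_right (y : Surreal.{u}) : StrictMono (· + y : Surreal.{u} → Surreal.{u}) :=
  fun x x' h => rel_of_lt (r := fun a b => a + y < b + y) (fun _ _ _ => lt_trans)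
    (fun z _ l hl => (add_mem_between z y).1 _ (Or.inl ⟨l, hl, rfl⟩))
    (fun z _ s hs => (add_mem_between z y).2 _ (Or.inl ⟨s, hs, rfl⟩))
    (Order.lt_succ_of_le (le_max_left x.length x'.length))
    (Order.lt_succ_of_le (le_max_right x.length x'.length)) h

theorem strictMono_add_left (x : Surreal.{u}) : StrictMono (x + · : Surreal.{u} → Surreal.{u}) :=
  fun y y' h => rel_of_lt (r := fun a b => x + a < x + b) (fun _ _ _ => lt_trans)
    (fun z _ l hl => (add_mem_between x z).1 _ (Or.inr ⟨l, hl, rfl⟩))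
    (fun z _ s hs => (add_mem_between x z).2 _ (Or.inr ⟨s, hs, rfl⟩))
    (Order.lt_succ_of_le (le_max_left y.length y'.length))
    (Order.lt_succ_of_le (le_max_right y.length y'.length)) h

theorem add_le_of_options {x y z : Surreal.{u}} (h1 : ∀ l ∈ leftOptions x, l + y < z)
    (h2 : ∀ l ∈ leftOptions y, x + l < z) (h3 : ∀ r ∈ rightOptions z, x + y < r) :
    x + y ≤ z := by
  refine le_of_options (add_eq_cut x y) (add_mem_between x y) (cut_options z).symm
    ⟨fun l h => h.2, fun r h => h.2⟩ ?_ h3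
  rintro _ (⟨l, hl, rfl⟩ | ⟨l, hl, rfl⟩)
  exacts [h1 l hl, h2 l hl]

theorem le_add_of_options {x y z : Surreal.{u}} (h1 : ∀ r ∈ rightOptions x, z < r + y)
    (h2 : ∀ r ∈ rightOptions y, z < x + r) (h3 : ∀ l ∈ leftOptions z, l < x + y) :
    z ≤ x + y := by
  refine le_of_options (cut_options z).symm ⟨fun l h => h.2, fun r h => h.2⟩
    (add_eq_cut x y) (add_mem_between x y) h3 ?_
  rintro _ (⟨l, hl, rfl⟩ | ⟨l, hl, rfl⟩)
  exacts [h1 l hl, h2 l hl]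

/-- The elements defining the cut `x + y` are cofinal in the canonical left options. -/
theorem exists_le_of_mem_leftOptions_add {x y p : Surreal.{u}} (h : p ∈ leftOptions (x + y)) :
    ∃ q ∈ addLeft x y, p ≤ q := by
  by_contra! hp
  have hm : p ∈ between (addLeft x y) (addRight x y) :=
    ⟨hp, fun r hr => h.2.trans ((add_mem_between x y).2 r hr)⟩
  have hle : (cut (addLeft x y) (addRight x y)).length ≤ p.length := length_simplest_le hm
  rw [← add_eq_cut] at hle
  exact hle.not_gt (length_lt_of_left h)

/-- The elements defining the cut `x + y` are coinitial in the canonical right options. -/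
theorem exists_le_of_mem_rightOptions_add {x y p : Surreal.{u}} (h : p ∈ rightOptions (x + y)) :
    ∃ q ∈ addRight x y, q ≤ p := by
  by_contra! hp
  have hm : p ∈ between (addLeft x y) (addRight x y) :=
    ⟨fun l hl => ((add_mem_between x y).1 l hl).trans h.2, hp⟩
  have hle : (cut (addLeft x y) (addRight x y)).length ≤ p.length := length_simplest_le hm
  rw [← add_eq_cut] at hle
  exact hle.not_gt (length_lt_of_right h)

theorem add_comm_le (x y : Surreal.{u}) : x + y ≤ y + x := by
  refine le_of_options (add_eq_cut x y) (add_mem_between x y) (add_eq_cut y x)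
    (add_mem_between y x) ?_ ?_
  · rintro _ (⟨l, hl, rfl⟩ | ⟨l, hl, rfl⟩)
    · exact (add_comm_le l y).trans_lt (strictMono_add_left y hl.2)
    · exact (add_comm_le x l).trans_lt (strictMono_add_right x hl.2)
  · rintro _ (⟨r, hr, rfl⟩ | ⟨r, hr, rfl⟩)
    · exact (strictMono_add_left x hr.2).trans_le (add_comm_le x r)
    · exact (strictMono_add_right y hr.2).trans_le (add_comm_le r y)
termination_by (x.length, y.length)
decreasing_by
  · exact Prod.Lex.left _ _ (length_lt_of_left hl)
  · exact Prod.Lex.right _ (length_lt_of_left hl)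
  · exact Prod.Lex.right _ (length_lt_of_right hr)
  · exact Prod.Lex.left _ _ (length_lt_of_right hr)

theorem add_assoc_le (x y z : Surreal.{u}) : x + y + z ≤ x + (y + z) := by
  refine le_of_options (add_eq_cut _ z) (add_mem_between _ z) (add_eq_cut x _)
    (add_mem_between x _) ?_ ?_
  · rintro _ (⟨p, hp, rfl⟩ | ⟨l, hl, rfl⟩)
    · obtain ⟨_, ⟨l, hl, rfl⟩ | ⟨l, hl, rfl⟩, hpq⟩ := exists_le_of_mem_leftOptions_add hp
      · exact (((strictMono_add_right z).monotone hpq).trans (add_assoc_le l y z)).trans_lt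
          (strictMono_add_right _ hl.2)
      · exact (((strictMono_add_right z).monotone hpq).trans (add_assoc_le x l z)).trans_lt
          (strictMono_add_left x (strictMono_add_right z hl.2))
    · exact (add_assoc_le x y l).trans_lt (strictMono_add_left x (strictMono_add_left y hl.2))
  · rintro _ (⟨r, hr, rfl⟩ | ⟨p, hp, rfl⟩)
    · exact (strictMono_add_right z (strictMono_add_right y hr.2)).trans_le (add_assoc_le r y z)
    · obtain ⟨_, ⟨r, hr, rfl⟩ | ⟨r, hr, rfl⟩, hpq⟩ := exists_le_of_mem_rightOptions_add hp
      · exact (strictMono_add_right z (strictMono_add_left x hr.2)).trans_le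
          ((add_assoc_le x r z).trans ((strictMono_add_left x).monotone hpq))
      · exact (strictMono_add_left (x + y) hr.2).trans_le
          ((add_assoc_le x y r).trans ((strictMono_add_left x).monotone hpq))
termination_by (x.length, y.length, z.length)
decreasing_by
  · exact Prod.Lex.left _ _ (length_lt_of_left hl)
  · exact Prod.Lex.right _ (Prod.Lex.left _ _ (length_lt_of_left hl))
  · exact Prod.Lex.right _ (Prod.Lex.right _ (length_lt_of_left hl))
  · exact Prod.Lex.left _ _ (length_lt_of_right hr)
  · exact Prod.Lex.right _ (Prod.Lex.left _ _ (length_lt_of_right hr))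
  · exact Prod.Lex.right _ (Prod.Lex.right _ (length_lt_of_right hr))

theorem leftOptions_zero : leftOptions (0 : Surreal.{u}) = ∅ :=
  Set.eq_empty_of_forall_notMem fun _ h => not_lt_zero (length_lt_of_left h)

theorem rightOptions_zero : rightOptions (0 : Surreal.{u}) = ∅ :=
  Set.eq_empty_of_forall_notMem fun _ h => not_lt_zero (length_lt_of_right h)

protected theorem add_zero (x : Surreal.{u}) : x + 0 = x := by
  have hL : (· + 0) '' leftOptions x = leftOptions x :=
    (Set.image_congr fun l hl => Surreal.add_zero l).trans (Set.image_id _)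
  have hR : (· + 0) '' rightOptions x = rightOptions x :=
    (Set.image_congr fun r hr => Surreal.add_zero r).trans (Set.image_id _)
  rw [add_eq_cut, addLeft, addRight, hL, hR, leftOptions_zero, rightOptions_zero, Set.image_empty,
    Set.union_empty, Set.union_empty, cut_options]
termination_by x.length
decreasing_by
  · exact length_lt_of_left hl
  · exact length_lt_of_right hr

protected theorem neg_neg (x : Surreal.{u}) : - -x = x :=
  sign_injective (funext fun β => _root_.neg_neg (x.sign β))

protected theorem neg_lt_neg {x y : Surreal.{u}} (h : x < y) : -y < -x := by
  obtain ⟨β, hβ, hlt⟩ := h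
  refine ⟨β, fun γ hγ => congrArg Neg.neg (hβ γ hγ).symm, ?_⟩
  change -(y.sign β) < -(x.sign β)
  revert hlt
  cases x.sign β <;> cases y.sign β <;> decide

theorem Simpler.neg {x y : Surreal.{u}} (h : x.Simpler y) : (-x).Simpler (-y) :=
  ⟨h.1, fun β hβ => congrArg Neg.neg (h.2 β hβ)⟩

theorem neg_mem_rightOptions {x l : Surreal.{u}} (h : l ∈ leftOptions (-x)) :
    -l ∈ rightOptions x := by
  have h1 := h.1.neg
  have h2 := Surreal.neg_lt_neg h.2
  rw [Surreal.neg_neg] at h1 h2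
  exact ⟨h1, h2⟩

theorem neg_mem_leftOptions {x r : Surreal.{u}} (h : r ∈ rightOptions (-x)) :
    -r ∈ leftOptions x := by
  have h1 := h.1.neg
  have h2 := Surreal.neg_lt_neg h.2
  rw [Surreal.neg_neg] at h1 h2
  exact ⟨h1, h2⟩

protected theorem add_neg_cancel (x : Surreal.{u}) : x + -x = 0 := by
  have hl : ∀ l ∈ leftOptions x, l + -l = 0 := fun l hl => Surreal.add_neg_cancel l
  have hr : ∀ r ∈ rightOptions x, r + -r = 0 := fun r hr => Surreal.add_neg_cancel r
  apply le_antisymm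
  · refine add_le_of_options (fun l h => ?_) (fun l h => ?_) (by simp [rightOptions_zero])
    · rw [← hl l h]
      exact strictMono_add_left l (Surreal.neg_lt_neg h.2)
    · have h' := neg_mem_rightOptions h
      rw [← hr _ h', Surreal.neg_neg]
      exact strictMono_add_right l h'.2
  · refine le_add_of_options (fun r h => ?_) (fun r h => ?_) (by simp [leftOptions_zero])
    · rw [← hr r h]
      exact strictMono_add_left r (Surreal.neg_lt_neg h.2)
    · have h' := neg_mem_leftOptions h
      rw [← hl _ h', Surreal.neg_neg]
      exact strictMono_add_right r h'.2
termination_by x.length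
decreasing_by
  · exact length_lt_of_left hl
  · exact length_lt_of_right hr

protected theorem add_comm (x y : Surreal.{u}) : x + y = y + x :=
  le_antisymm (add_comm_le x y) (add_comm_le y x)

protected theorem add_assoc (x y z : Surreal.{u}) : x + y + z = x + (y + z) := by
  refine le_antisymm (add_assoc_le x y z) ?_
  have h := add_assoc_le z y x
  rwa [Surreal.add_comm z y, Surreal.add_comm _ x, Surreal.add_comm y x, Surreal.add_comm z] at h

/-- Multiples are those of `nsmulRec`, as in the definition of the omega map. -/
noncomputable instance : AddCommGroup Surreal.{u} where
  add_assoc := Surreal.add_assoc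
  zero_add x := (Surreal.add_comm 0 x).trans (Surreal.add_zero x)
  add_zero := Surreal.add_zero
  nsmul := nsmulRec
  zsmul := zsmulRec
  neg_add_cancel x := (Surreal.add_comm (-x) x).trans (Surreal.add_neg_cancel x)
  add_comm := Surreal.add_comm

instance : IsOrderedAddMonoid Surreal.{u} where
  add_le_add_left _ _ h z := (strictMono_add_right z).monotone h

theorem nsmulRec_eq_nsmul (n : ℕ) (x : Surreal.{u}) : nsmulRec n x = n • x := rfl

/-! ### The omega map -/

/-- A strict upper bound of a small class closed under addition up to domination can be halved
without losing that property. -/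
theorem exists_add_self_le {L : Set Surreal.{u}} [Small.{u} L]
    (hadd : ∀ x ∈ L, ∀ y ∈ L, ∃ z ∈ L, x + y ≤ z) {a : Surreal.{u}} (ha : ∀ l ∈ L, l < a) :
    ∃ w, (∀ l ∈ L, l < w) ∧ w + w ≤ a := by
  -- For `b` between `L` and `a - L`, both `b` and `a - b` lie above `L`; the smaller one works.
  obtain ⟨b, hb, hb'⟩ := between_nonempty (L := L) (R := (a - ·) '' L) (by
    rintro l hl _ ⟨m, hm, rfl⟩
    obtain ⟨z, hz, hle⟩ := hadd l hl m hm
    exact lt_sub_iff_add_lt.2 (hle.trans_lt (ha z hz)))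
  refine ⟨min b (a - b), fun l hl => lt_min (hb l hl) ?_, ?_⟩
  · exact lt_sub_comm.1 (hb' _ ⟨l, hl, rfl⟩)
  · exact (add_le_add (min_le_left _ _) (min_le_right _ _)).trans (add_sub_cancel b a).le

theorem exists_two_pow_nsmul_le {L : Set Surreal.{u}} [Small.{u} L]
    (hadd : ∀ x ∈ L, ∀ y ∈ L, ∃ z ∈ L, x + y ≤ z) {a : Surreal.{u}} (ha : ∀ l ∈ L, l < a)
    (n : ℕ) : ∃ w, (∀ l ∈ L, l < w) ∧ 2 ^ n • w ≤ a := by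
  induction n with
  | zero => exact ⟨a, ha, by simp⟩
  | succ n ih =>
    obtain ⟨w, hw, hwa⟩ := ih
    obtain ⟨w', hw', hle⟩ := exists_add_self_le hadd hw
    refine ⟨w', hw', le_trans ?_ hwa⟩
    rw [pow_succ, mul_nsmul', two_nsmul]
    exact nsmul_le_nsmul_right hle _

/-- The class of which `omega x` is the simplest element. -/
def omegaClass (x : Surreal.{u}) : Set Surreal.{u} :=
  {z | 0 < z ∧ (∀ l ∈ leftOptions x, ∀ n : ℕ, n • omega l < z) ∧
    (∀ r ∈ rightOptions x, ∀ n : ℕ, n • z < omega r)}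

theorem omega_eq_simplest (x : Surreal.{u}) : omega x = simplest (omegaClass x) := by
  rw [omega]
  rfl

/-- `a` is positive and infinitesimal relative to `b`. -/
def InfinitelyLess (a b : Surreal.{u}) : Prop := 0 < a ∧ ∀ n : ℕ, n • a < b

theorem InfinitelyLess.trans {a b c : Surreal.{u}} (h : InfinitelyLess a b)
    (h' : InfinitelyLess b c) : InfinitelyLess a c :=
  ⟨h.1, fun n => (h.2 n).trans (by simpa using h'.2 1)⟩

theorem infinitelyLess_omega_of_lt {o : Ordinal.{u}}
    (hmem : ∀ x : Surreal.{u}, x.length < o → omega x ∈ omegaClass x) {x y : Surreal.{u}}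
    (hx : x.length < o) (hy : y.length < o) (h : x < y) :
    InfinitelyLess (omega x) (omega y) :=
  rel_of_lt (r := fun a b => InfinitelyLess (omega a) (omega b))
    (fun _ _ _ h h' => h.trans h')
    (fun z hz l hl => ⟨(hmem l ((length_lt_of_left hl).trans hz)).1, (hmem z hz).2.1 l hl⟩)
    (fun z hz r hr => ⟨(hmem z hz).1, (hmem z hz).2.2 r hr⟩) hx hy h

/-- The recursion for the omega map is legitimate: the class defining `omega x` is nonempty. The
conditions `n z < ω^(xᴿ)` are met by taking `z` below elements `w` with `2^n w ≤ ω^(xᴿ)`. -/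
theorem omega_mem_omegaClass (x : Surreal.{u}) : omega x ∈ omegaClass x := by
  have ih : ∀ y : Surreal.{u}, y.length < x.length → omega y ∈ omegaClass y :=
    fun y hy => omega_mem_omegaClass y
  rw [omega_eq_simplest x]
  apply simplest_mem
  let L : Set Surreal.{u} :=
    insert 0 (Set.range fun p : leftOptions x × ℕ => p.2 • omega p.1.1)
  have hpos : ∀ l : leftOptions x, 0 ≤ omega l.1 :=
    fun l => (ih l.1 (length_lt_of_left l.2)).1.le
  have hadd : ∀ a ∈ L, ∀ b ∈ L, ∃ c ∈ L, a + b ≤ c := by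
    rintro _ (rfl | ⟨⟨l, m⟩, rfl⟩) _ (rfl | ⟨⟨l', m'⟩, rfl⟩)
    · exact ⟨0, Or.inl rfl, by simp⟩
    · exact ⟨_, Or.inr ⟨(l', m'), rfl⟩, by simp⟩
    · exact ⟨_, Or.inr ⟨(l, m), rfl⟩, by simp⟩
    · rcases le_total (omega l.1) (omega l'.1) with h | h
      · refine ⟨_, Or.inr ⟨(l', m + m'), rfl⟩, ?_⟩
        simp only [add_nsmul]
        exact add_le_add_left (nsmul_le_nsmul_right h m) _
      · refine ⟨_, Or.inr ⟨(l, m + m'), rfl⟩, ?_⟩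
        simp only [add_nsmul]
        exact add_le_add_right (nsmul_le_nsmul_right h m') _
  have hL : ∀ r : rightOptions x, ∀ a ∈ L, a < omega r.1 := by
    rintro ⟨r, hr⟩ _ (rfl | ⟨⟨⟨l, hl⟩, m⟩, rfl⟩)
    · exact (ih r (length_lt_of_right hr)).1
    · exact (infinitelyLess_omega_of_lt ih (length_lt_of_left hl) (length_lt_of_right hr)
        (hl.2.trans hr.2)).2 m
  choose w hw hle using fun p : rightOptions x × ℕ =>
    exists_two_pow_nsmul_le hadd (hL p.1) p.2
  obtain ⟨z, hz, hz'⟩ := between_nonempty (L := L) (R := Set.range w) (by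
    rintro l hl _ ⟨p, rfl⟩
    exact hw p l hl)
  have hz0 : 0 < z := hz 0 (Or.inl rfl)
  refine ⟨z, hz0, fun l hl n => hz _ (Or.inr ⟨(⟨l, hl⟩, n), rfl⟩), fun r hr n => ?_⟩
  calc n • z ≤ 2 ^ n • z := nsmul_le_nsmul_left hz0.le Nat.lt_two_pow_self.le
    _ < 2 ^ n • w (⟨r, hr⟩, n) := nsmul_lt_nsmul_right (by positivity) (hz' _ ⟨_, rfl⟩)
    _ ≤ omega r := hle (⟨r, hr⟩, n)
termination_by x.length
decreasing_by exact hy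

theorem omega_pos (x : Surreal.{u}) : 0 < omega x := (omega_mem_omegaClass x).1

theorem nsmul_omega_lt_omega {x y : Surreal.{u}} (h : x < y) (n : ℕ) :
    n • omega x < omega y :=
  (infinitelyLess_omega_of_lt (fun z _ => omega_mem_omegaClass z)
    (Order.lt_succ_of_le (le_max_left x.length y.length))
    (Order.lt_succ_of_le (le_max_right x.length y.length)) h).2 n

theorem abs_omega (x : Surreal.{u}) : abs (omega x) = omega x :=
  if_neg (omega_pos x).not_gt

/-- Distinct powers of `ω` lie in distinct archimedean classes. -/
theorem archEquiv_omega_iff {x y : Surreal.{u}} : ArchEquiv (omega x) (omega y) ↔ x = y := by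
  simp only [ArchEquiv, abs_omega, nsmulRec_eq_nsmul]
  constructor
  · rintro ⟨n, h1, h2⟩
    by_contra hne
    rcases lt_or_gt_of_ne hne with h | h
    · exact h2.not_gt (nsmul_omega_lt_omega h n)
    · exact h1.not_gt (nsmul_omega_lt_omega h n)
  · rintro rfl
    have h : omega x < 2 • omega x := by
      rw [two_nsmul]
      exact lt_add_of_pos_left _ (omega_pos x)
    exact ⟨2, h, h⟩

theorem v_omega (x : Surreal.{u}) : v (omega x) = ((-x : Surreal.{u}) : WithTop Surreal.{u}) := by
  rw [v, if_neg (omega_pos x).ne']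
  have h : ArchEquiv (omega x) (omega (Classical.epsilon fun y => ArchEquiv (omega x) (omega y))) :=
    Classical.epsilon_spec (p := fun y => ArchEquiv (omega x) (omega y))
      ⟨x, archEquiv_omega_iff.2 rfl⟩
  rw [← archEquiv_omega_iff.1 h]

theorem v_monomial (g : Surreal.{u}) : v (monomial g) = g := by
  rw [monomial, v_omega, neg_neg]

/-! ### The identity is an internal automorphism -/

theorem zero_lt_one' : (0 : Surreal.{u}) < 1 := by
  refine ⟨0, fun γ hγ => absurd hγ not_lt_zero, ?_⟩
  change (0 : SignType) < if (0 : Ordinal.{u}) = 0 then 1 else 0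
  rw [if_pos rfl]
  decide

theorem length_eq_zero {x : Surreal.{u}} (h : x.length = 0) : x = 0 :=
  sign_injective (funext fun β => (x.sign_eq_zero_iff β).2 (h ▸ zero_le))

theorem leftOptions_one : leftOptions (1 : Surreal.{u}) = {0} := by
  ext l
  constructor
  · exact fun h => length_eq_zero (Order.lt_one_iff.1 (length_lt_of_left h))
  · rintro rfl
    exact ⟨⟨zero_lt_one (α := Ordinal.{u}), fun β hβ => absurd hβ not_lt_zero⟩,
      zero_lt_one'⟩

theorem rightOptions_one : rightOptions (1 : Surreal.{u}) = ∅ := by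
  refine Set.eq_empty_of_forall_notMem fun r h => ?_
  have h0 : r = 0 := length_eq_zero (Order.lt_one_iff.1 (length_lt_of_right h))
  exact absurd h.2 (h0 ▸ zero_lt_one'.not_gt)

theorem omega_zero : omega (0 : Surreal.{u}) = 1 := by
  have h1 : (1 : Surreal.{u}) ∈ omegaClass 0 :=
    ⟨zero_lt_one', by simp [leftOptions_zero], by simp [rightOptions_zero]⟩
  have hlen : (omega (0 : Surreal.{u})).length ≤ 1 :=
    omega_eq_simplest (0 : Surreal.{u}) ▸ length_simplest_le h1
  have hpos := omega_pos (0 : Surreal.{u})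
  have hle : (1 : Surreal.{u}) ≤ omega 0 := by
    refine le_of_options (cut_options 1).symm ⟨fun l h => h.2, fun r h => h.2⟩
      (cut_options _).symm ⟨fun l h => h.2, fun r h => h.2⟩ ?_ ?_
    · simpa [leftOptions_one] using hpos
    · -- A right option would have length `0`, that is, be `0`.
      intro r hr
      have h0 : r = 0 := length_eq_zero
        (Order.lt_one_iff.1 ((length_lt_of_right hr).trans_le hlen))
      exact absurd (hpos.trans hr.2) (h0 ▸ lt_irrefl _)
  rcases eq_or_simpler_of_mem_between_options (x := 1) (z := omega 0)
    (by simpa [between, leftOptions_one, rightOptions_one] using hpos) with h | h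
  · exact h
  · exact absurd h.1 hlen.not_gt

protected theorem mul_zero (x : Surreal.{u}) : x * 0 = 0 := by
  change mul x 0 = 0
  rw [mul]
  simp only [leftOptions_zero, rightOptions_zero, Set.mem_empty_iff_false, IsEmpty.exists_iff,
    exists_false, Set.ofPred_false, Set.union_self]
  have h := cut_options (0 : Surreal.{u})
  rwa [leftOptions_zero, rightOptions_zero] at h

protected theorem mul_one (x : Surreal.{u}) : x * 1 = x := by
  have hl : ∀ l ∈ leftOptions x, mul l 1 = l := fun l hl => Surreal.mul_one l
  have hr : ∀ r ∈ rightOptions x, mul r 1 = r := fun r hr => Surreal.mul_one r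
  have h0 : ∀ y : Surreal.{u}, mul y 0 = 0 := Surreal.mul_zero
  change mul x 1 = x
  rw [mul]
  conv_rhs => rw [← cut_options x]
  congr 1
  · ext z
    simp only [leftOptions_one, rightOptions_one, Set.mem_empty_iff_false, IsEmpty.exists_iff,
      exists_false, Set.ofPred_false, Set.union_empty, Set.mem_singleton_iff, exists_prop,
      exists_eq_left, h0, add_zero, sub_zero, Set.mem_ofPred_eq]
    exact ⟨fun ⟨a, ha, hz⟩ => by rwa [hz, hl a ha], fun hz => ⟨z, hz, (hl z hz).symm⟩⟩
  · ext z
    simp only [leftOptions_one, rightOptions_one, Set.mem_empty_iff_false, IsEmpty.exists_iff,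
      exists_false, Set.ofPred_false, Set.empty_union, Set.mem_singleton_iff, exists_prop,
      exists_eq_left, h0, add_zero, sub_zero, Set.mem_ofPred_eq]
    exact ⟨fun ⟨a, ha, hz⟩ => by rwa [hz, hr a ha], fun hz => ⟨z, hz, (hr z hz).symm⟩⟩
termination_by x.length
decreasing_by
  · exact length_lt_of_left hl
  · exact length_lt_of_right hr

theorem hasCoeff_ofReal (r : ℝ) : HasCoeff (ofReal.{u} r) 0 r := by
  rw [HasCoeff, monomial, neg_zero, omega_zero, Surreal.mul_one, sub_self, v, if_pos rfl]
  exact WithTop.coe_lt_top _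

theorem refl_mem_oneAut : RingEquiv.refl Surreal.{u} ∈ oneAut :=
  ⟨⟨fun _ _ => Iff.rfl, v_monomial, hasCoeff_ofReal⟩, fun _ _ _ _ => Iff.rfl⟩

/-! ### Rigidity -/

theorem eq_refl_of_v_omega {σ : Surreal.{u} ≃+* Surreal.{u}} (hσ : σ ∈ omegaAut)
    (hv : ∀ x, v (σ (omega x)) = v (omega x)) : σ = RingEquiv.refl Surreal.{u} := by
  refine RingEquiv.ext fun x => ?_
  have h := hv x
  rw [hσ x, v_omega, v_omega, WithTop.coe_inj, neg_inj] at h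
  exact h

end Surreal

theorem mainTheorem7 :
    (∀ σ : Surreal.{u} ≃+* Surreal.{u}, σ ∈ Surreal.omegaAut →
      (∀ a, Surreal.v (σ a) = Surreal.v a) → σ = RingEquiv.refl Surreal.{u}) ∧
    (Surreal.oneAut ∩ Surreal.omegaAut : Set (Surreal.{u} ≃+* Surreal.{u})) =
      {RingEquiv.refl Surreal.{u}} := by
  refine ⟨fun σ hσ hv => Surreal.eq_refl_of_v_omega hσ fun x => hv _, ?_⟩
  refine Set.Subset.antisymm ?_ ?_
  · rintro σ ⟨h1, hσ⟩
    refine Surreal.eq_refl_of_v_omega hσ fun x => ?_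
    have h := h1.1.2.1 (-x)
    rwa [Surreal.monomial, neg_neg, ← Surreal.v_omega] at h
  · rintro _ rfl
    exact ⟨Surreal.refl_mem_oneAut, fun _ => rfl⟩
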